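/- Let $\pi\in C^\infty(\widetilde{\mathcal N},\mathcal N)$ be a Riemannian covering, that is, a smooth covering map between Riemannian manifolds which pulls the metric of $\mathcal N$ back to that of $\widetilde{\mathcal N}$, where $\widetilde{\mathcal N}$ and $\mathcal N$ are connected. Let $\mathcal M$ be a relatively compact connected open subset of an $m$-dimensional Riemannian manifold $\mathcal M'$. Let $0<s<1$ and let $p$ be a real number with $sp\ge 1$ (so $1<p<\infty$). Write $d_{\mathcal M}$, $d_{\widetilde{\mathcal N}}$ for the geodesic distances on $\mathcal M$ and $\widetilde{\mathcal N}$, and $\mathrm dx$ for the $m$-dimensional Hausdorff measure on $\mathcal M$. Let $W^{s,p}(\mathcal M,\widetilde{\mathcal N})$ be the set of measurable maps $w:\mathcal M\to\widetilde{\mathcal N}$ such that $$\int_{\mathcal M}\int_{\mathcal M}\frac{d_{\widetilde{\mathcal N}}(w(x),w(y))^p}{d_{\mathcal M}(x,y)^{m+sp}}\,\mathrm dx\,\mathrm dy<\infty ,$$ and let $W^{s,p}_{loc}(\mathcal M,\widetilde{\mathcal N})$ be the set of measurable maps for which the same integral over $K\times K$ is finite for every compact $K\subset\mathcal M$. A subset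 of $\mathcal M$ is negligible if it is Lebesgue null in local coordinates, and "a.e." means outside a negligible set. (i) Let $\widetilde u,\widetilde v\in W^{s,p}_{loc}(\mathcal M,\widetilde{\mathcal N})$ satisfy $\pi\circ\widetilde u=\pi\circ\widetilde v$ a.e. on $\mathcal M$, and assume that $\widetilde u$ is continuous. Then either $\widetilde u=\widetilde v$ a.e. on $\mathcal M$, or $\widetilde u\ne\widetilde v$ a.e. on $\mathcal M$. (ii) Let $\widetilde u\in W^{s,p}_{loc}(\mathcal M,\widetilde{\mathcal N})\setminus W^{s,p}(\mathcal M,\widetilde{\mathcal N})$ be continuous. If $\widetilde v\in W^{s,p}(\mathcal M,\widetilde{\mathcal N})$ satisfies $\pi\circ\widetilde v=\pi\circ\widetilde u$ a.e. on $\mathcal M$, then $\widetilde u\ne\widetilde v$ a.e. on $\mathcal M$. -/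

import Mathlib

open MeasureTheory Set Bundle
open scoped Manifold ContDiff ENNReal

noncomputable section

/-- A Riemannian covering between `n`-dimensional Riemannian manifolds: a smooth covering map
whose differential pulls the metric of the base back to the metric of the total space. -/
structure IsRiemannianCovering (n : ℕ) {C B : Type*}
    [TopologicalSpace C] [ChartedSpace (EuclideanSpace ℝ (Fin n)) C]
    [RiemannianBundle (fun x : C => TangentSpace (𝓡 n) x)]
    [TopologicalSpace B] [ChartedSpace (EuclideanSpace ℝ (Fin n)) B]
    [RiemannianBundle (fun x : B => TangentSpace (𝓡 n) x)]
    (proj : C → B) : Prop where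
  contMDiff : ContMDiff (𝓡 n) (𝓡 n) ∞ proj
  isCoveringMap : IsCoveringMap proj
  inner_mfderiv : ∀ (x : C) (v w : TangentSpace (𝓡 n) x),
    inner ℝ (mfderiv (𝓡 n) (𝓡 n) proj x v) (mfderiv (𝓡 n) (𝓡 n) proj x w) = inner ℝ v w

/-- The geodesic distance of the open set `Ω`, seen as a Riemannian manifold of its own: the
infimum of the lengths of the `C^1` paths that join `x` to `y` inside `Ω`
(it is `⊤` if there is no such path). -/
def geodesicEDistIn (m : ℕ) {X : Type*}
    [TopologicalSpace X] [ChartedSpace (EuclideanSpace ℝ (Fin m)) X]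
    [RiemannianBundle (fun x : X => TangentSpace (𝓡 m) x)]
    (Ω : Set X) (x y : X) : ℝ≥0∞ :=
  ⨅ (γ : ℝ → X) (_ : γ 0 = x ∧ γ 1 = y ∧ MapsTo γ (Icc 0 1) Ω ∧
    ContMDiffOn 𝓘(ℝ, ℝ) (𝓡 m) 1 γ (Icc 0 1)), Manifold.pathELength (𝓡 m) γ 0 1

/-- A set is negligible if it is Lebesgue null in local coordinates. -/
def IsNegligible (m : ℕ) {X : Type*}
    [TopologicalSpace X] [ChartedSpace (EuclideanSpace ℝ (Fin m)) X] (S : Set X) : Prop :=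
  ∀ x : X, volume ((extChartAt (𝓡 m) x) '' (S ∩ (extChartAt (𝓡 m) x).source)) = 0

/-- `P` holds almost everywhere on `Ω`. -/
def HoldsAEOn (m : ℕ) {X : Type*}
    [TopologicalSpace X] [ChartedSpace (EuclideanSpace ℝ (Fin m)) X]
    (Ω : Set X) (P : X → Prop) : Prop :=
  IsNegligible m {x | x ∈ Ω ∧ ¬ P x}

section Sobolev

variable (m : ℕ) {X Y : Type*} [EMetricSpace X] [MeasurableSpace X] [BorelSpace X]
  [ChartedSpace (EuclideanSpace ℝ (Fin m)) X]
  [RiemannianBundle (fun x : X => TangentSpace (𝓡 m) x)] [EMetricSpace Y]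

/-- The `p`-th power of the Gagliardo semi-norm, integrated over `A × A` with `A ⊆ Ω`,
`∫_A ∫_A d_Y(u(x), u(y))^p / d_Ω(x, y)^(m + s p) dx dy`, where `d_Ω` is the geodesic distance
of `Ω` and the measure is the `m`-dimensional Hausdorff measure. The integrand is `0` on the
diagonal. -/
def gagliardoEnergyOn (Ω A : Set X) (s p : ℝ) (u : X → Y) : ℝ≥0∞ :=
  ∫⁻ x in A, ∫⁻ y in A,
    edist (u x) (u y) ^ p / geodesicEDistIn m Ω x y ^ ((m : ℝ) + s * p) ∂μH[(m : ℝ)] ∂μH[(m : ℝ)]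

/-- `u ∈ W^{s,p}(Ω, Y)`; only the values of `u` on `Ω` matter. -/
def MemSobolev (Ω : Set X) (s p : ℝ) (u : X → Y) : Prop :=
  AEStronglyMeasurable u (μH[(m : ℝ)].restrict Ω) ∧ gagliardoEnergyOn m Ω Ω s p u < ⊤

/-- `u ∈ W^{s,p}_loc(Ω, Y)`. -/
def MemSobolevLoc (Ω : Set X) (s p : ℝ) (u : X → Y) : Prop :=
  AEStronglyMeasurable u (μH[(m : ℝ)].restrict Ω) ∧
    ∀ K : Set X, K ⊆ Ω → IsCompact K → gagliardoEnergyOn m Ω K s p u < ⊤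

end Sobolev

end

/-! Let A be the set where the two lifts agree. Near a point x₀, continuity keeps u close to u(x₀),
inside an open set on which the projection is injective. If v(x) = u(x) but v(y) ≠ u(y), with equal
projections at y, then v(y) must lie outside that open set, so d(v(x), v(y)) is at least a fixed δ >
0. The energy of v therefore dominates a multiple of the energy of the indicator of A, whose kernel
has exponent m + sp ≥ m + 1 (`exists_mem_nhds_coincidence_null`).

An indicator with finite energy for so singular a kernel is constant a.e. on a convex set
(`measure_inter_eq_zero_or_diff_eq_zero`). Indeed, if x and y lie on different sides of A, their
midpoint is separated from one of them, at half the distance. Integrating, the pairs at distance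
below 2ρ contribute no more than those at distance below ρ. Iterating, the contribution is bounded
by that of arbitrarily close pairs, which tends to 0 because the total is finite.

Bi-Lipschitz charts carry this to the manifold (`exists_chart_ball`,
`hausdorffMeasure_inter_eq_zero_or_diff_eq_zero`), and connectedness makes it global. For (ii), a.e.
equality would give u the finite energy of v. -/

/-! ### Separated pairs and the midpoint halving argument in a convex set. -/

/-- The pairs of points of `D` that are separated by `A`. -/
def separatedPairs {E : Type*} (D A : Set E) : Set (E × E) :=
  {z | z.1 ∈ D ∧ z.2 ∈ D ∧ ¬(z.1 ∈ A ↔ z.2 ∈ A)}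

lemma measurableSet_separatedPairs {E : Type*} [MeasurableSpace E] {D A : Set E}
    (hD : MeasurableSet D) (hA : MeasurableSet A) :
    MeasurableSet (separatedPairs D A) := by
  have h1 : MeasurableSet {z : E × E | z.1 ∈ D} := measurable_fst hD
  have h2 : MeasurableSet {z : E × E | z.2 ∈ D} := measurable_snd hD
  have h3 : MeasurableSet {z : E × E | z.1 ∈ A} := measurable_fst hA
  have h4 : MeasurableSet {z : E × E | z.2 ∈ A} := measurable_snd hA
  exact h1.inter (h2.inter (h3.iff h4).compl)

lemma edist_left_midpoint_mul {E : Type*} [NormedAddCommGroup E] [NormedSpace ℝ E] (x y : E) :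
    edist x y = 2 * edist x (midpoint ℝ x y) := by
  rw [edist_dist, edist_dist, dist_left_midpoint (𝕜 := ℝ),
    ← ENNReal.ofReal_ofNat 2, ← ENNReal.ofReal_mul (by norm_num), Real.norm_ofNat,
    ← mul_assoc, mul_inv_cancel₀ two_ne_zero, one_mul]

lemma edist_midpoint_right_mul {E : Type*} [NormedAddCommGroup E] [NormedSpace ℝ E] (x y : E) :
    edist x y = 2 * edist (midpoint ℝ x y) y := by
  rw [edist_comm x y, edist_left_midpoint_mul, midpoint_comm, edist_comm]

section ConvexDoubling

variable {E : Type*} [NormedAddCommGroup E] [NormedSpace ℝ E] [FiniteDimensional ℝ E]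
  [MeasurableSpace E] [BorelSpace E] (μ : Measure E) [μ.IsAddHaarMeasure]

/-- With one endpoint fixed, taking the midpoint is a translation followed by a contraction of ratio
1/2, whose Jacobian gives the factor. -/
lemma lintegral_comp_midpoint_left {h : E → ℝ≥0∞} (hh : Measurable h) (x : E) :
    ∫⁻ y, h (midpoint ℝ x y) ∂μ = 2 ^ Module.finrank ℝ E * ∫⁻ y, h y ∂μ := by
  have h1 : ∀ y, midpoint ℝ x y = (2⁻¹ : ℝ) • (x + y) := by
    intro y; rw [midpoint_eq_smul_add, invOf_eq_inv]
  simp_rw [h1]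
  rw [lintegral_add_left_eq_self (fun y => h ((2⁻¹ : ℝ) • y)) x,
    ← lintegral_map hh (measurable_const_smul (2⁻¹ : ℝ)),
    Measure.map_addHaar_smul μ (by norm_num), lintegral_smul_measure]
  congr 1
  rw [inv_pow, inv_inv, abs_of_pos (by positivity), ENNReal.ofReal_pow (by norm_num)]
  norm_num

variable {D A : Set E} {q : ℝ}

/-- The contribution of the close pairs does not decrease when the scale is halved. -/
lemma lintegral_separatedPairs_le_half (hDc : Convex ℝ D) (hD : MeasurableSet D)
    (hA : MeasurableSet A) (hq : Module.finrank ℝ E + 1 ≤ q) (ρ : ℝ≥0∞) :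
    ∫⁻ z in separatedPairs D A ∩ {z | edist z.1 z.2 < 2 * ρ}, edist z.1 z.2 ^ (-q) ∂μ.prod μ ≤
    ∫⁻ z in separatedPairs D A ∩ {z | edist z.1 z.2 < ρ}, edist z.1 z.2 ^ (-q) ∂μ.prod μ := by
  have hP := measurableSet_separatedPairs hD hA
  have hk : Measurable (fun z : E × E => edist z.1 z.2 ^ (-q)) :=
    (measurable_fst.edist measurable_snd).pow_const _
  have hS : ∀ r : ℝ≥0∞, MeasurableSet {z : E × E | edist z.1 z.2 < r} := fun r =>
    measurableSet_lt (measurable_fst.edist measurable_snd) measurable_const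
  rw [← lintegral_indicator (hP.inter (hS _)), ← lintegral_indicator (hP.inter (hS _))]
  set g := (separatedPairs D A ∩ {z | edist z.1 z.2 < ρ}).indicator
    (fun z : E × E => edist z.1 z.2 ^ (-q)) with hg
  have hgm : Measurable g := hk.indicator (hP.inter (hS _))
  have hmid : Measurable (fun z : E × E => midpoint ℝ z.1 z.2) := by
    simp_rw [midpoint_eq_smul_add]
    fun_prop
  -- The midpoint lies in D by convexity, and it is on the opposite side of A from at least one
  -- endpoint. Halving the distance turns the kernel into 2 ^ (-q) times its value at the shorter
  -- pair.
  have key : ∀ z : E × E, (separatedPairs D A ∩ {z | edist z.1 z.2 < 2 * ρ}).indicator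
      (fun z : E × E => edist z.1 z.2 ^ (-q)) z ≤
      2 ^ (-q) * (g (z.1, midpoint ℝ z.1 z.2) + g (midpoint ℝ z.1 z.2, z.2)) := by
    intro z
    by_cases hz : z ∈ separatedPairs D A ∩ {z | edist z.1 z.2 < 2 * ρ}
    · rw [indicator_of_mem hz]
      obtain ⟨⟨h1, h2, h3⟩, h4⟩ := hz
      have hm : midpoint ℝ z.1 z.2 ∈ D := hDc.midpoint_mem h1 h2
      have e1 := edist_left_midpoint_mul z.1 z.2
      have e2 := edist_midpoint_right_mul z.1 z.2
      have l1 : edist z.1 (midpoint ℝ z.1 z.2) < ρ := by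
        have h4' : edist z.1 z.2 < 2 * ρ := h4
        rw [e1] at h4'
        exact lt_of_mul_lt_mul_left' h4'
      have l2 : edist (midpoint ℝ z.1 z.2) z.2 < ρ := by
        have h4' : edist z.1 z.2 < 2 * ρ := h4
        rw [e2] at h4'
        exact lt_of_mul_lt_mul_left' h4'
      by_cases hs : (z.1 ∈ A ↔ midpoint ℝ z.1 z.2 ∈ A)
      · have : (midpoint ℝ z.1 z.2, z.2) ∈ separatedPairs D A ∩ {z | edist z.1 z.2 < ρ} :=
          ⟨⟨hm, h2, fun h => h3 (hs.trans h)⟩, l2⟩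
        calc edist z.1 z.2 ^ (-q) = 2 ^ (-q) * g (midpoint ℝ z.1 z.2, z.2) := by
              rw [hg, indicator_of_mem this, e2,
                ENNReal.mul_rpow_of_ne_top (by simp) (edist_ne_top _ _)]
          _ ≤ _ := by gcongr; exact le_add_self
      · have : (z.1, midpoint ℝ z.1 z.2) ∈ separatedPairs D A ∩ {z | edist z.1 z.2 < ρ} :=
          ⟨⟨h1, hm, hs⟩, l1⟩
        calc edist z.1 z.2 ^ (-q) = 2 ^ (-q) * g (z.1, midpoint ℝ z.1 z.2) := by
              rw [hg, indicator_of_mem this, e1,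
                ENNReal.mul_rpow_of_ne_top (by simp) (edist_ne_top _ _)]
          _ ≤ _ := by gcongr; exact le_self_add
    · rw [indicator_of_notMem hz]; exact zero_le
  have m1 : Measurable (fun z : E × E => g (z.1, midpoint ℝ z.1 z.2)) :=
    hgm.comp (measurable_fst.prodMk hmid)
  have m2 : Measurable (fun z : E × E => g (midpoint ℝ z.1 z.2, z.2)) :=
    hgm.comp (hmid.prodMk measurable_snd)
  have i1 : ∫⁻ z, g (z.1, midpoint ℝ z.1 z.2) ∂μ.prod μ =
      2 ^ Module.finrank ℝ E * ∫⁻ z, g z ∂μ.prod μ := by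
    rw [lintegral_prod _ m1.aemeasurable, lintegral_prod _ hgm.aemeasurable,
      ← lintegral_const_mul _ hgm.lintegral_prod_right']
    refine lintegral_congr fun x => ?_
    exact lintegral_comp_midpoint_left μ (hgm.comp measurable_prodMk_left) x
  have i2 : ∫⁻ z, g (midpoint ℝ z.1 z.2, z.2) ∂μ.prod μ =
      2 ^ Module.finrank ℝ E * ∫⁻ z, g z ∂μ.prod μ := by
    rw [lintegral_prod_symm _ m2.aemeasurable, lintegral_prod_symm _ hgm.aemeasurable,
      ← lintegral_const_mul _ hgm.lintegral_prod_left']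
    refine lintegral_congr fun y => ?_
    simp_rw [midpoint_comm (R := ℝ) _ y]
    exact lintegral_comp_midpoint_left μ (hgm.comp measurable_prodMk_right) y
  -- The critical exponent appears here: two half-pairs, a Jacobian 2 ^ d for each, and a gain 2 ^
  -- (-q), so q ≥ d + 1 is what is needed.
  have hc : (2 : ℝ≥0∞) ^ (-q) * (2 * 2 ^ Module.finrank ℝ E) ≤ 1 := by
    rw [← pow_succ', ← ENNReal.rpow_natCast, ← ENNReal.rpow_add _ _ (by simp) (by simp)]
    exact by
      refine (ENNReal.rpow_le_rpow_of_exponent_le (z := 0) (by norm_num) ?_).trans_eq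
        ENNReal.rpow_zero
      push_cast
      linarith
  calc _ ≤ ∫⁻ z, 2 ^ (-q) * (g (z.1, midpoint ℝ z.1 z.2) + g (midpoint ℝ z.1 z.2, z.2))
        ∂μ.prod μ := lintegral_mono key
    _ = (2 ^ (-q) * (2 * 2 ^ Module.finrank ℝ E)) * ∫⁻ z, g z ∂μ.prod μ := by
        rw [lintegral_const_mul' _ _ (by simp), lintegral_add_left m1, i1, i2]
        ring
    _ ≤ 1 * ∫⁻ z, g z ∂μ.prod μ := by gcongr
    _ = _ := one_mul _

/-- If a measurable subset of a convex set has finite energy for a kernel as singular as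
`‖x - y‖ ^ (-(d + 1))`, then it is null or conull. -/
theorem measure_inter_eq_zero_or_diff_eq_zero (hDc : Convex ℝ D) (hD : MeasurableSet D)
    (hA : MeasurableSet A) (hq : Module.finrank ℝ E + 1 ≤ q)
    (hfin : ∫⁻ z in separatedPairs D A, edist z.1 z.2 ^ (-q) ∂μ.prod μ ≠ ⊤) :
    μ (D ∩ A) = 0 ∨ μ (D \ A) = 0 := by
  have hP := measurableSet_separatedPairs hD hA
  have hk : Measurable (fun z : E × E => edist z.1 z.2 ^ (-q)) :=
    (measurable_fst.edist measurable_snd).pow_const _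
  have hS : ∀ r : ℝ≥0∞, MeasurableSet {z : E × E | edist z.1 z.2 < r} := fun r =>
    measurableSet_lt (measurable_fst.edist measurable_snd) measurable_const
  have hq0 : 0 < q := by
    have : (0 : ℝ) ≤ Module.finrank ℝ E := Nat.cast_nonneg _
    linarith
  set κ := (μ.prod μ).withDensity (fun z : E × E => edist z.1 z.2 ^ (-q)) with hκ
  set P := separatedPairs D A with hPdef
  have hfin' : κ P ≠ ⊤ := by rwa [hκ, withDensity_apply _ hP]
  have hhalf : ∀ ρ : ℝ≥0∞, κ (P ∩ {z | edist z.1 z.2 < 2 * ρ}) ≤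
      κ (P ∩ {z | edist z.1 z.2 < ρ}) := by
    intro ρ
    rw [hκ, withDensity_apply _ (hP.inter (hS _)), withDensity_apply _ (hP.inter (hS _))]
    exact lintegral_separatedPairs_le_half μ hDc hD hA hq ρ
  have hsmall : ∀ n : ℕ, κ (P ∩ {z | edist z.1 z.2 < 2 ^ n}) = 0 := by
    intro n
    have step : ∀ k : ℕ, κ (P ∩ {z | edist z.1 z.2 < 2 ^ n}) ≤
        κ (P ∩ {z | edist z.1 z.2 < 2 ^ n * (2⁻¹) ^ k}) := by
      intro k
      induction k with
      | zero => simp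
      | succ k ih =>
        refine ih.trans ?_
        have : (2 : ℝ≥0∞) ^ n * 2⁻¹ ^ k = 2 * (2 ^ n * 2⁻¹ ^ (k + 1)) := by
          rw [pow_succ', mul_left_comm, ← mul_assoc 2, ENNReal.mul_inv_cancel (by simp) (by simp),
            one_mul]
        rw [this]
        exact hhalf _
    have lim : Filter.Tendsto (fun k : ℕ => κ (P ∩ {z | edist z.1 z.2 < 2 ^ n * (2⁻¹) ^ k}))
        Filter.atTop (nhds (κ (⋂ k : ℕ, P ∩ {z | edist z.1 z.2 < 2 ^ n * (2⁻¹) ^ k}))) := by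
      refine tendsto_measure_iInter_atTop
        (fun k => (hP.inter (hS _)).nullMeasurableSet) ?_ ⟨0, ?_⟩
      · intro i j hij z hz
        refine ⟨hz.1, lt_of_lt_of_le (show edist z.1 z.2 < _ from hz.2) ?_⟩
        gcongr 2 ^ n * ?_
        exact pow_le_pow_right_of_le_one' (by norm_num) hij
      · exact ne_top_of_le_ne_top hfin' (measure_mono inter_subset_left)
    -- A pair lying in all these sets would be on the diagonal, but no point is separated from
    -- itself.
    have hempty : (⋂ k : ℕ, P ∩ {z : E × E | edist z.1 z.2 < 2 ^ n * (2⁻¹) ^ k}) = ∅ := by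
      refine eq_empty_iff_forall_notMem.2 fun z hz => ?_
      rw [mem_iInter] at hz
      have h0 : edist z.1 z.2 ≤ 0 := by
        have : Filter.Tendsto (fun k : ℕ => (2 : ℝ≥0∞) ^ n * (2⁻¹) ^ k) Filter.atTop
            (nhds (2 ^ n * 0)) :=
          ENNReal.Tendsto.const_mul
            (ENNReal.tendsto_pow_atTop_nhds_zero_of_lt_one (by norm_num))
            (Or.inr (by finiteness))
        rw [mul_zero] at this
        exact ge_of_tendsto' this fun k => (hz k).2.le
      have : z.1 = z.2 := by simpa using h0
      exact (hz 0).1.2.2 (by rw [this])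
    rw [hempty, measure_empty] at lim
    exact le_antisymm (ge_of_tendsto' lim step) zero_le
  have hκP : κ P = 0 := by
    refine measure_mono_null (t := ⋃ n : ℕ, P ∩ {z | edist z.1 z.2 < 2 ^ n}) ?_
      (measure_iUnion_null hsmall)
    intro z hz
    obtain ⟨n, hn⟩ := exists_nat_gt (edist z.1 z.2).toReal
    refine mem_iUnion.2 ⟨n, hz, ?_⟩
    have h1 : edist z.1 z.2 < (n : ℝ≥0∞) := by
      rw [← ENNReal.ofReal_toReal (edist_ne_top z.1 z.2), ← ENNReal.ofReal_natCast]
      exact (ENNReal.ofReal_lt_ofReal_iff_of_nonneg ENNReal.toReal_nonneg).2 hn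
    exact h1.trans_le (by exact_mod_cast (Nat.lt_two_pow_self (n := n)).le)
  -- Distances in E are finite, so the kernel never vanishes and a null set for the weighted measure
  -- is null for the product measure.
  have hprod : (μ.prod μ) P = 0 := by
    rw [hκ, withDensity_apply_eq_zero hk] at hκP
    refine measure_mono_null (fun z hz => mem_inter ?_ hz) hκP
    simp only [mem_ofPred_eq, ne_eq, ENNReal.rpow_eq_zero_iff, not_or, not_and]
    exact ⟨fun _ => by linarith, fun h => absurd h (edist_ne_top _ _)⟩
  have : (μ.prod μ) ((D ∩ A) ×ˢ (D \ A)) = 0 := by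
    refine measure_mono_null ?_ hprod
    rintro ⟨x, y⟩ ⟨hx, hy⟩
    exact ⟨hx.1, hy.1, fun h => hy.2 (h.1 hx.2)⟩
  rwa [Measure.prod_prod, mul_eq_zero] at this

end ConvexDoubling

/-! ### Local Lipschitz estimates for charts of a Riemannian manifold. -/

lemma ContinuousLinearMap.enorm_apply_le_of_enorm_lt {E F : Type*} [SeminormedAddCommGroup E]
    [SeminormedAddCommGroup F] [NormedSpace ℝ E] [NormedSpace ℝ F] (f : E →L[ℝ] F) (C : NNReal)
    (h : ‖f‖ₑ < C) (v : E) : ‖f v‖ₑ ≤ C * ‖v‖ₑ :=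
  (f.le_opENorm v).trans (mul_le_mul_left h.le _)

section RiemannianCharts

open Manifold Metric
open scoped NNReal Topology

section
variable {E H M : Type*} [NormedAddCommGroup E] [NormedSpace ℝ E] [TopologicalSpace H]
  (I : ModelWithCorners ℝ E H) [TopologicalSpace M] [ChartedSpace H M] [IsManifold I 1 M]
  [RiemannianBundle (fun x : M => TangentSpace I x)]
  [IsContinuousRiemannianBundle E (fun x : M => TangentSpace I x)]

attribute [local instance] normedAddCommGroupTangentSpaceVectorSpace
  normedSpaceTangentSpaceVectorSpace

/-- The inverse of a chart has locally bounded derivative. -/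
lemma exists_enorm_mfderivWithin_symm_extChartAt_le (x₀ : M) :
    ∃ C : ℝ≥0, ∀ᶠ a in 𝓝[range I] (extChartAt I x₀ x₀), ∀ v : TangentSpace 𝓘(ℝ, E) a,
      ‖mfderivWithin 𝓘(ℝ, E) I (extChartAt I x₀).symm (range I) a v‖ₑ ≤ C * ‖(v : E)‖ₑ := by
  obtain ⟨C, -, hC⟩ := eventually_enorm_mfderivWithin_symm_extChartAt_lt I x₀
  refine ⟨C, ?_⟩
  filter_upwards [hC] with a ha v
  exact ContinuousLinearMap.enorm_apply_le_of_enorm_lt _ C ha v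

/-- A chart has locally bounded derivative. -/
lemma exists_enorm_mfderiv_extChartAt_le (x₀ : M) :
    ∃ C : ℝ≥0, ∀ᶠ y in 𝓝 x₀, ∀ v : TangentSpace I y,
      ‖(mfderiv I 𝓘(ℝ, E) (extChartAt I x₀) y v : E)‖ₑ ≤ C * ‖v‖ₑ := by
  obtain ⟨C, -, hC⟩ := eventually_enorm_mfderiv_extChartAt_lt I x₀
  refine ⟨C, ?_⟩
  filter_upwards [hC] with a ha v
  exact @ContinuousLinearMap.enorm_apply_le_of_enorm_lt _ _ _ _ _ _ _ C ha v

/-- The length of a segment pulled back by a chart is controlled by its length in the chart. -/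
lemma exists_pathELength_symm_extChartAt_comp_lineMap_le (x₀ : M) :
    ∃ C : ℝ≥0, ∃ r > 0, ball (extChartAt I x₀ x₀) r ∩ range I ⊆ (extChartAt I x₀).target ∧
      ∀ a ∈ ball (extChartAt I x₀ x₀) r ∩ range I, ∀ b ∈ ball (extChartAt I x₀ x₀) r ∩ range I,
      pathELength I ((extChartAt I x₀).symm ∘ ContinuousAffineMap.lineMap (R := ℝ) a b) 0 1
        ≤ C * edist a b := by
  obtain ⟨C, hC⟩ := exists_enorm_mfderivWithin_symm_extChartAt_le I x₀
  obtain ⟨r, r_pos, hr⟩ := mem_nhdsWithin_iff.1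
    (Filter.inter_mem (extChartAt_target_mem_nhdsWithin x₀) hC)
  refine ⟨C, r, r_pos, fun z hz => (hr hz).1, fun a ha b hb => ?_⟩
  set η : ℝ →ᴬ[ℝ] E := ContinuousAffineMap.lineMap (R := ℝ) a b with hη_def
  have hη : ∀ t ∈ Icc (0 : ℝ) 1, η t ∈ ball (extChartAt I x₀ x₀) r ∩ range I := by
    intro t ht
    refine ((convex_ball _ _).inter I.convex_range).segment_subset ha hb ?_
    rw [segment_eq_image_lineMap]
    exact ⟨t, ht, rfl⟩
  have hηt : Icc (0 : ℝ) 1 ⊆ η ⁻¹' (extChartAt I x₀).target := fun t ht => (hr (hη t ht)).1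
  have η_smooth : ContMDiffOn 𝓘(ℝ, ℝ) 𝓘(ℝ, E) 1 η (Icc 0 1) := by
    apply ContMDiff.contMDiffOn
    rw [contMDiff_iff_contDiff]
    exact ContinuousAffineMap.contDiff _
  rw [← lintegral_fderiv_lineMap_eq_edist, pathELength_eq_lintegral_mfderivWithin_Icc,
    ← lintegral_const_mul' _ _ ENNReal.coe_ne_top]
  apply setLIntegral_mono' measurableSet_Icc (fun t ht ↦ ?_)
  have h1 : mfderivWithin 𝓘(ℝ, ℝ) I ((extChartAt I x₀).symm ∘ η) (Icc 0 1) t =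
      (mfderivWithin 𝓘(ℝ, E) I (extChartAt I x₀).symm (range I) (η t)) ∘L
        (mfderivWithin 𝓘(ℝ, ℝ) 𝓘(ℝ, E) η (Icc 0 1) t) := by
    apply mfderivWithin_comp
    · exact mdifferentiableWithinAt_extChartAt_symm (hηt ht)
    · exact η_smooth.mdifferentiableOn one_ne_zero t ht
    · exact hηt.trans (preimage_mono (extChartAt_target_subset_range x₀))
    · rw [uniqueMDiffWithinAt_iff_uniqueDiffWithinAt]
      exact uniqueDiffOn_Icc zero_lt_one t ht
  have h2 : mfderivWithin 𝓘(ℝ, ℝ) I ((extChartAt I x₀).symm ∘ η) (Icc 0 1) t 1 =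
      (mfderivWithin 𝓘(ℝ, E) I (extChartAt I x₀).symm (range I) (η t))
        (mfderivWithin 𝓘(ℝ, ℝ) 𝓘(ℝ, E) η (Icc 0 1) t 1) := congr($h1 1)
  rw [h2]
  refine ((hr (hη t ht)).2 _).trans ?_
  rw [mfderivWithin_eq_fderivWithin]
  exact le_rfl

end

/-- Charts of a Riemannian manifold are locally Lipschitz. -/
lemma exists_lipschitzOnWith_extChartAt {E H M : Type*} [NormedAddCommGroup E] [NormedSpace ℝ E]
    [TopologicalSpace H] (I : ModelWithCorners ℝ E H) [PseudoEMetricSpace M] [ChartedSpace H M]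
    [IsManifold I 1 M] [RiemannianBundle (fun x : M => TangentSpace I x)]
    [IsContinuousRiemannianBundle E (fun x : M => TangentSpace I x)]
    [IsRiemannianManifold I M] (x₀ : M) :
    ∃ C : ℝ≥0, ∃ W ∈ 𝓝 x₀, LipschitzOnWith C (extChartAt I x₀) W := by
  obtain ⟨C, hC⟩ := exists_enorm_mfderiv_extChartAt_le I x₀
  obtain ⟨ε, ε_pos, hε⟩ := EMetric.mem_nhds_iff.1
    (Filter.inter_mem (extChartAt_source_mem_nhds (I := I) x₀) hC)
  -- A path starting in the ball of radius ε / 3 with length below 2 ε / 3 stays in the ε-ball,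
  -- where the derivative bound holds.
  have hε3 : 0 < ε / 3 := ENNReal.div_pos ε_pos.ne' (by simp)
  refine ⟨C, eball x₀ (ε / 3), eball_mem_nhds _ hε3, fun y hy z hz => ?_⟩
  rw [mem_eball] at hy hz
  have main : ∀ L : ℝ≥0∞, edist y z < L → L ≤ ε / 3 + ε / 3 →
      edist (extChartAt I x₀ y) (extChartAt I x₀ z) ≤ C * L := by
    intro L hL hLε
    rw [IsRiemannianManifold.out (I := I) y z] at hL
    obtain ⟨γ, γ0, γ1, hγ, hγL⟩ := exists_lt_of_riemannianEDist_lt hL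
    have hmem : ∀ t ∈ Icc (0 : ℝ) 1, γ t ∈ eball x₀ ε := by
      intro t ht
      have h1 : edist y (γ t) < L := by
        rw [IsRiemannianManifold.out (I := I) y (γ t)]
        exact ((riemannianEDist_le_pathELength (hγ.mono (Icc_subset_Icc_right ht.2)) γ0 rfl
          ht.1).trans (pathELength_mono le_rfl ht.2)).trans_lt hγL
      rw [mem_eball, edist_comm]
      calc edist x₀ (γ t) ≤ edist x₀ y + edist y (γ t) := edist_triangle _ _ _
        _ < ε / 3 + (ε / 3 + ε / 3) :=
            ENNReal.add_lt_add (by rwa [edist_comm]) (h1.trans_le hLε)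
        _ = ε := by rw [← add_assoc, ENNReal.add_thirds]
    have hsrc : ∀ t ∈ Icc (0 : ℝ) 1, γ t ∈ (chartAt H x₀).source := fun t ht => by
      simpa using (hε (hmem t ht)).1
    set γ' : ℝ → E := extChartAt I x₀ ∘ γ with hγ'
    have hγ'C : ContMDiffOn 𝓘(ℝ, ℝ) 𝓘(ℝ, E) 1 γ' (Icc 0 1) :=
      contMDiffOn_extChartAt.comp (I' := I) (t := (chartAt H x₀).source) hγ hsrc
    calc edist (extChartAt I x₀ y) (extChartAt I x₀ z) = ‖γ' 1 - γ' 0‖ₑ := by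
          rw [edist_comm, edist_eq_enorm_sub, hγ', Function.comp, Function.comp, γ0, γ1]
      _ ≤ ∫⁻ t in Icc 0 1, ‖derivWithin γ' (Icc 0 1) t‖ₑ := by
          apply enorm_sub_le_lintegral_derivWithin_Icc_of_contDiffOn_Icc _ zero_le_one
          rwa [← contMDiffOn_iff_contDiffOn]
      _ ≤ ∫⁻ t in Icc 0 1, C * ‖mfderivWithin 𝓘(ℝ, ℝ) I γ (Icc 0 1) t 1‖ₑ := by
          apply setLIntegral_mono' measurableSet_Icc (fun t ht ↦ ?_)
          have h1 : mfderivWithin 𝓘(ℝ, ℝ) 𝓘(ℝ, E) γ' (Icc 0 1) t =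
              (mfderiv I 𝓘(ℝ, E) (extChartAt I x₀) (γ t)) ∘L
                (mfderivWithin 𝓘(ℝ, ℝ) I γ (Icc 0 1) t) := by
            apply mfderiv_comp_mfderivWithin
            · exact mdifferentiableAt_extChartAt (hsrc t ht)
            · exact hγ.mdifferentiableOn one_ne_zero _ ht
            · rw [uniqueMDiffWithinAt_iff_uniqueDiffWithinAt]
              exact uniqueDiffOn_Icc zero_lt_one _ ht
          have h2 : derivWithin γ' (Icc 0 1) t = (mfderiv I 𝓘(ℝ, E) (extChartAt I x₀) (γ t))
              (mfderivWithin 𝓘(ℝ, ℝ) I γ (Icc 0 1) t 1) := by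
            rw [← fderivWithin_derivWithin, ← mfderivWithin_eq_fderivWithin]
            exact congr($h1 1)
          rw [h2]
          exact (hε (hmem t ht)).2 _
      _ = C * pathELength I γ 0 1 := by
          rw [lintegral_const_mul' _ _ ENNReal.coe_ne_top,
            pathELength_eq_lintegral_mfderivWithin_Icc]
      _ ≤ C * L := by gcongr
  have hyz : edist y z < ε / 3 + ε / 3 :=
    (edist_triangle_right _ _ x₀).trans_lt (ENNReal.add_lt_add hy hz)
  have hC' : edist (extChartAt I x₀ y) (extChartAt I x₀ z) / C ≤ edist y z := by
    refine le_of_forall_gt fun b hb => ?_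
    obtain ⟨b', h1, h2⟩ := exists_between (lt_min hb hyz)
    refine lt_of_le_of_lt (ENNReal.div_le_of_le_mul' (main b' h1 ?_)) (h2.trans_le (min_le_left _ _))
    exact (h2.trans_le (min_le_right _ _)).le
  -- Multiplying back by C requires C ≠ 0; for C = 0 a single admissible L already forces the two
  -- images to coincide.
  by_cases hC0 : (C : ℝ≥0∞) = 0
  · obtain ⟨b', h1, h2⟩ := exists_between hyz
    have := main b' h1 h2.le
    rw [hC0, zero_mul] at this
    exact this.trans zero_le
  · exact (ENNReal.div_le_iff_le_mul (Or.inl hC0) (Or.inl ENNReal.coe_ne_top)).1 hC' |>.trans_eq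
      (mul_comm _ _)

end RiemannianCharts

/-! ### Chart balls, geodesic distance and negligible sets. -/

section ChartBalls

open Manifold Metric
open scoped NNReal Topology

/-- A smooth Riemannian metric is continuous. -/
instance isContinuousRiemannianBundle_tangentSpace {m : ℕ} {X : Type*} [TopologicalSpace X]
    [ChartedSpace (EuclideanSpace ℝ (Fin m)) X] [IsManifold (𝓡 m) ∞ X]
    [RiemannianBundle (fun x : X => TangentSpace (𝓡 m) x)]
    [IsContMDiffRiemannianBundle (𝓡 m) ∞ (EuclideanSpace ℝ (Fin m))
      (fun x : X => TangentSpace (𝓡 m) x)] :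
    IsContinuousRiemannianBundle (EuclideanSpace ℝ (Fin m))
      (fun x : X => TangentSpace (𝓡 m) x) := by
  obtain ⟨g, hg, hg'⟩ := IsContMDiffRiemannianBundle.exists_contMDiff (IB := 𝓡 m) (n := ∞)
    (F := EuclideanSpace ℝ (Fin m)) (E := fun x : X => TangentSpace (𝓡 m) x)
  exact ⟨g, hg.continuous, hg'⟩

variable {m : ℕ} {X : Type*} [EMetricSpace X]
  [ChartedSpace (EuclideanSpace ℝ (Fin m)) X] [IsManifold (𝓡 m) ∞ X]
  [RiemannianBundle (fun x : X => TangentSpace (𝓡 m) x)]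
  [IsContMDiffRiemannianBundle (𝓡 m) ∞ (EuclideanSpace ℝ (Fin m))
    (fun x : X => TangentSpace (𝓡 m) x)]

/-- The pulled-back segment is a competitor for the infimum, and it stays in Ω because balls are
convex. Allowing every r' ≤ r lets the ball shrink later with the same constant. -/
lemma geodesicEDistIn_symm_extChartAt_le (x₀ : X) :
    ∃ C : ℝ≥0, ∃ r > 0, ball (extChartAt (𝓡 m) x₀ x₀) r ⊆ (extChartAt (𝓡 m) x₀).target ∧
      ∀ r' ≤ r, ∀ Ω : Set X,
      MapsTo (extChartAt (𝓡 m) x₀).symm (ball (extChartAt (𝓡 m) x₀ x₀) r') Ω →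
      ∀ a ∈ ball (extChartAt (𝓡 m) x₀ x₀) r', ∀ b ∈ ball (extChartAt (𝓡 m) x₀ x₀) r',
      geodesicEDistIn m Ω ((extChartAt (𝓡 m) x₀).symm a) ((extChartAt (𝓡 m) x₀).symm b)
        ≤ C * edist a b := by
  obtain ⟨C, r, r_pos, hr, h⟩ := exists_pathELength_symm_extChartAt_comp_lineMap_le (𝓡 m) x₀
  rw [ModelWithCorners.range_eq_univ, inter_univ] at hr h
  refine ⟨C, r, r_pos, hr, fun r' hr' Ω hΩ a ha b hb => ?_⟩
  refine le_trans ?_ (h a (ball_subset_ball hr' ha) b (ball_subset_ball hr' hb))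
  set η : ℝ →ᴬ[ℝ] EuclideanSpace ℝ (Fin m) := ContinuousAffineMap.lineMap (R := ℝ) a b
    with hη_def
  have hη : ∀ t ∈ Icc (0 : ℝ) 1, η t ∈ ball (extChartAt (𝓡 m) x₀ x₀) r' := by
    intro t ht
    refine (convex_ball _ _).segment_subset ha hb ?_
    rw [segment_eq_image_lineMap]
    exact ⟨t, ht, rfl⟩
  have η_smooth : ContMDiff 𝓘(ℝ, ℝ) (𝓡 m) 1 η := by
    rw [contMDiff_iff_contDiff]
    exact ContinuousAffineMap.contDiff _
  refine iInf₂_le ((extChartAt (𝓡 m) x₀).symm ∘ η) ⟨?_, ?_, ?_, ?_⟩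
  · simp [hη_def, ContinuousAffineMap.coe_lineMap_eq]
  · simp [hη_def, ContinuousAffineMap.coe_lineMap_eq]
  · exact fun t ht => hΩ (hη t ht)
  · exact (contMDiffOn_extChartAt_symm x₀).comp η_smooth.contMDiffOn
      fun t ht => hr (ball_subset_ball hr' (hη t ht))

variable [IsRiemannianManifold (𝓡 m) X]

omit [IsManifold (𝓡 m) ∞ X] [IsContMDiffRiemannianBundle (𝓡 m) ∞ (EuclideanSpace ℝ (Fin m))
    (fun x : X => TangentSpace (𝓡 m) x)] in
lemma edist_le_geodesicEDistIn (Ω : Set X) (x y : X) : edist x y ≤ geodesicEDistIn m Ω x y := by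
  rw [IsRiemannianManifold.out (I := 𝓡 m) x y]
  exact le_iInf₂ fun γ hγ => riemannianEDist_le_pathELength hγ.2.2.2 hγ.1 hγ.2.1 zero_le_one

/-- Small chart balls around a point on which the chart is bi-Lipschitz and controls the
geodesic distance of every set that contains the ball. -/
lemma exists_chart_ball (x₀ : X) {U : Set X} (hU : U ∈ 𝓝 x₀) :
    ∃ C : ℝ≥0, C ≠ 0 ∧ ∃ r > 0,
      ball (extChartAt (𝓡 m) x₀ x₀) r ⊆ (extChartAt (𝓡 m) x₀).target ∧
      MapsTo (extChartAt (𝓡 m) x₀).symm (ball (extChartAt (𝓡 m) x₀ x₀) r) U ∧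
      (extChartAt (𝓡 m) x₀).symm '' ball (extChartAt (𝓡 m) x₀ x₀) r ∈ 𝓝 x₀ ∧
      IsOpen ((extChartAt (𝓡 m) x₀).symm '' ball (extChartAt (𝓡 m) x₀ x₀) r) ∧
      LipschitzOnWith C (extChartAt (𝓡 m) x₀)
        ((extChartAt (𝓡 m) x₀).symm '' ball (extChartAt (𝓡 m) x₀ x₀) r) ∧
      LipschitzOnWith C (extChartAt (𝓡 m) x₀).symm (ball (extChartAt (𝓡 m) x₀ x₀) r) ∧
      ∀ Ω, MapsTo (extChartAt (𝓡 m) x₀).symm (ball (extChartAt (𝓡 m) x₀ x₀) r) Ω →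
        ∀ a ∈ ball (extChartAt (𝓡 m) x₀ x₀) r, ∀ b ∈ ball (extChartAt (𝓡 m) x₀ x₀) r,
        geodesicEDistIn m Ω ((extChartAt (𝓡 m) x₀).symm a) ((extChartAt (𝓡 m) x₀).symm b)
          ≤ C * edist a b := by
  obtain ⟨C₁, r₁, hr₁, ht, hg⟩ := geodesicEDistIn_symm_extChartAt_le (m := m) x₀
  obtain ⟨C₂, W, hW, hL⟩ := exists_lipschitzOnWith_extChartAt (𝓡 m) x₀
  have hc : (extChartAt (𝓡 m) x₀).symm ⁻¹' (W ∩ U) ∈ 𝓝 (extChartAt (𝓡 m) x₀ x₀) :=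
    extChartAt_preimage_mem_nhds (Filter.inter_mem hW hU)
  obtain ⟨r₂, hr₂, hb⟩ := Metric.mem_nhds_iff.1 hc
  set r := min r₁ r₂
  have h1 : ball (extChartAt (𝓡 m) x₀ x₀) r ⊆ ball (extChartAt (𝓡 m) x₀ x₀) r₁ :=
    ball_subset_ball (min_le_left _ _)
  have h2 : ball (extChartAt (𝓡 m) x₀ x₀) r ⊆ ball (extChartAt (𝓡 m) x₀ x₀) r₂ :=
    ball_subset_ball (min_le_right _ _)
  have hr : 0 < r := lt_min hr₁ hr₂
  have hopen : IsOpen ((extChartAt (𝓡 m) x₀).symm '' ball (extChartAt (𝓡 m) x₀ x₀) r) := by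
    rw [(extChartAt (𝓡 m) x₀).symm_image_eq_source_inter_preimage (h1.trans ht)]
    exact (continuousOn_extChartAt x₀).isOpen_inter_preimage (isOpen_extChartAt_source x₀)
      isOpen_ball
  have hg' : ∀ Ω, MapsTo (extChartAt (𝓡 m) x₀).symm (ball (extChartAt (𝓡 m) x₀ x₀) r) Ω →
        ∀ a ∈ ball (extChartAt (𝓡 m) x₀ x₀) r, ∀ b ∈ ball (extChartAt (𝓡 m) x₀ x₀) r,
        geodesicEDistIn m Ω ((extChartAt (𝓡 m) x₀).symm a) ((extChartAt (𝓡 m) x₀).symm b)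
          ≤ (max C₁ C₂ + 1 : ℝ≥0) * edist a b := fun Ω hΩ a ha b hb =>
    (hg r (min_le_left _ _) Ω hΩ a ha b hb).trans (by
      gcongr; exact (le_max_left _ _).trans le_self_add)
  -- Adding 1 makes the constant nonzero, so that its negative powers are finite.
  refine ⟨max C₁ C₂ + 1, by positivity, r, hr, h1.trans ht, fun a ha => (hb (h2 ha)).2,
    hopen.mem_nhds ⟨_, mem_ball_self hr, extChartAt_to_inv x₀⟩, hopen, ?_, ?_, hg'⟩
  · refine (hL.weaken ((le_max_right _ _).trans le_self_add)).mono ?_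
    rintro _ ⟨a, ha, rfl⟩
    exact (hb (h2 ha)).1
  · exact fun a ha b hb =>
      (edist_le_geodesicEDistIn (m := m) univ _ _).trans (hg' univ (mapsTo_univ _ _) a ha b hb)

/-- A chart is locally Lipschitz around every point of its source. -/
lemma exists_lipschitzOnWith_extChartAt_of_mem_source {x y : X}
    (hy : y ∈ (extChartAt (𝓡 m) x).source) :
    ∃ C : ℝ≥0, ∃ W ∈ 𝓝 y, LipschitzOnWith C (extChartAt (𝓡 m) x) W := by
  obtain ⟨C₁, W, hW, hL⟩ := exists_lipschitzOnWith_extChartAt (𝓡 m) y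
  -- Near y the chart at x is the transition map, which is C^1 and so locally Lipschitz, composed
  -- with the chart centred at y.
  have hd : ContDiffAt ℝ 1 (extChartAt (𝓡 m) x ∘ (extChartAt (𝓡 m) y).symm)
      (extChartAt (𝓡 m) y y) := by
    rw [← contDiffWithinAt_univ, ← ModelWithCorners.range_eq_univ (𝓡 m)]
    refine contDiffWithinAt_ext_coord_change x y ?_
    simpa [PartialEquiv.trans_source] using hy
  obtain ⟨C₂, t, ht, hLt⟩ := hd.exists_lipschitzOnWith
  refine ⟨C₂ * C₁, _, Filter.inter_mem (Filter.inter_mem hW (extChartAt_source_mem_nhds (I := 𝓡 m) y))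
    ((continuousAt_extChartAt (I := 𝓡 m) y).preimage_mem_nhds ht), ?_⟩
  intro z hz w hw
  have h := hLt.comp (s := W ∩ (extChartAt (𝓡 m) y).source ∩ extChartAt (𝓡 m) y ⁻¹' t)
    (hL.mono fun z hz => hz.1.1) (fun z hz => hz.2) hz hw
  simpa only [Function.comp_apply, (extChartAt (𝓡 m) y).left_inv hz.1.2,
    (extChartAt (𝓡 m) y).left_inv hw.1.2] using h

variable [SecondCountableTopology X] [MeasurableSpace X] [BorelSpace X]

/-- A set is negligible if and only if its Hausdorff measure vanishes. -/
lemma isNegligible_iff_hausdorffMeasure_eq_zero {S : Set X} :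
    IsNegligible m S ↔ μH[(m : ℝ)] S = 0 := by
  -- Both measures are Haar measures on Euclidean space, hence have the same null sets.
  have hvol : ∀ T : Set (EuclideanSpace ℝ (Fin m)), volume T = 0 ↔ μH[(m : ℝ)] T = 0 := fun T =>
    ⟨fun h => Measure.absolutelyContinuous_isAddHaarMeasure _ _ h,
      fun h => Measure.absolutelyContinuous_isAddHaarMeasure _ _ h⟩
  constructor
  · intro h
    refine measure_null_of_locally_null S fun x _ => ?_
    obtain ⟨C, -, r, hr, ht, -, hV, -, -, hL, -⟩ :=
      exists_chart_ball (m := m) x (Filter.univ_mem (f := 𝓝 x))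
    refine ⟨_, inter_mem_nhdsWithin S hV, ?_⟩
    have hx := (hvol _).1 (h x)
    have hnull : μH[(m : ℝ)] (((extChartAt (𝓡 m) x) '' (S ∩ (extChartAt (𝓡 m) x).source)) ∩
        ball (extChartAt (𝓡 m) x x) r) = 0 := measure_mono_null inter_subset_left hx
    have him := (hL.mono (s := ((extChartAt (𝓡 m) x) '' (S ∩ (extChartAt (𝓡 m) x).source)) ∩
        ball (extChartAt (𝓡 m) x x) r) inter_subset_right).hausdorffMeasure_image_le
        (d := m) (Nat.cast_nonneg m)
    rw [hnull, mul_zero] at him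
    refine measure_mono_null ?_ (le_antisymm him zero_le)
    rintro _ ⟨hS, a, ha, rfl⟩
    refine ⟨a, ⟨⟨_, ⟨hS, (extChartAt (𝓡 m) x).map_target (ht ha)⟩, ?_⟩, ha⟩, rfl⟩
    exact (extChartAt (𝓡 m) x).right_inv (ht ha)
  · intro h x
    rw [hvol]
    refine measure_null_of_locally_null _ ?_
    rintro _ ⟨y, ⟨hyS, hy⟩, rfl⟩
    obtain ⟨C, W, hW, hL⟩ := exists_lipschitzOnWith_extChartAt_of_mem_source (m := m) hy
    refine ⟨_, Filter.inter_mem self_mem_nhdsWithin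
      (mem_nhdsWithin_of_mem_nhds (extChartAt_preimage_mem_nhds' hy hW)), ?_⟩
    have him := (hL.mono (s := S ∩ W) inter_subset_right).hausdorffMeasure_image_le
      (d := m) (Nat.cast_nonneg m)
    rw [measure_mono_null inter_subset_left h, mul_zero] at him
    refine measure_mono_null ?_ (le_antisymm him zero_le)
    rintro _ ⟨⟨z, ⟨hzS, hz⟩, rfl⟩, hzW⟩
    rw [mem_preimage, (extChartAt (𝓡 m) x).left_inv hz] at hzW
    exact ⟨z, ⟨hzS, hzW⟩, rfl⟩

end ChartBalls

/-! ### Transfer of the dichotomy through a bi-Lipschitz chart. -/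

section BiLipschitzTransfer

open Metric
open scoped NNReal Topology

/-- The dichotomy `measure_inter_eq_zero_or_diff_eq_zero`, read in a bi-Lipschitz chart. -/
lemma hausdorffMeasure_inter_eq_zero_or_diff_eq_zero {m : ℕ} {X : Type*} [EMetricSpace X]
    [MeasurableSpace X] [BorelSpace X] {φ : X → EuclideanSpace ℝ (Fin m)}
    {ψ : EuclideanSpace ℝ (Fin m) → X} {D : Set (EuclideanSpace ℝ (Fin m))} {C : ℝ≥0} {q : ℝ}
    (hDc : Convex ℝ D) (hD : MeasurableSet D) (hV : MeasurableSet (ψ '' D))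
    (hφψ : ∀ a ∈ D, φ (ψ a) = a) (hφ : LipschitzOnWith C φ (ψ '' D))
    (hψ : LipschitzOnWith C ψ D) (hq : (m : ℝ) + 1 ≤ q) {A : Set X} (hA : MeasurableSet A)
    {F : X → X → ℝ≥0∞} {c : ℝ≥0∞} (hc0 : c ≠ 0) (hc : c ≠ ⊤)
    (hF : ∫⁻ x in ψ '' D, ∫⁻ y in ψ '' D, F x y ∂μH[(m : ℝ)] ∂μH[(m : ℝ)] ≠ ⊤)
    (hle : ∀ᵐ x ∂(μH[(m : ℝ)].restrict (ψ '' D)), ∀ᵐ y ∂(μH[(m : ℝ)].restrict (ψ '' D)),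
      ¬(x ∈ A ↔ y ∈ A) → c * edist (φ x) (φ y) ^ (-q) ≤ F x y) :
    μH[(m : ℝ)] (ψ '' D ∩ A) = 0 ∨ μH[(m : ℝ)] (ψ '' D \ A) = 0 := by
  set V := ψ '' D with hVdef
  set A' : Set (EuclideanSpace ℝ (Fin m)) := D ∩ ψ ⁻¹' A with hA'def
  have hA' : MeasurableSet A' := by
    have h := hD.subtype_image
      ((continuousOn_iff_continuous_domRestrict.1 hψ.continuousOn).measurable hA)
    convert! h using 1
    ext a
    simp [hA'def, and_comm]
  set lam : Measure (EuclideanSpace ℝ (Fin m)) := μH[(m : ℝ)].restrict D with hlam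
  set ν : Measure (EuclideanSpace ℝ (Fin m)) := (μH[(m : ℝ)].restrict V).map φ with hν
  have hφm : AEMeasurable φ (μH[(m : ℝ)].restrict V) := hφ.continuousOn.aemeasurable hV
  set c' : ℝ≥0∞ := (C : ℝ≥0∞) ^ (m : ℝ) with hc'
  have hc'top : c' ≠ ⊤ := ENNReal.rpow_ne_top_of_nonneg (Nat.cast_nonneg m) ENNReal.coe_ne_top
  -- The Lipschitz bound for φ compares measures in one direction only, which suffices for bounding
  -- integrals over D by integrals over V.
  have hlamν : lam ≤ c' • ν := by
    refine Measure.le_iff.2 fun T hT => ?_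
    rw [hlam, Measure.restrict_apply hT, Measure.smul_apply, smul_eq_mul, hν,
      Measure.map_apply_of_aemeasurable hφm hT, Measure.restrict_apply' hV]
    have h1 : T ∩ D ⊆ φ '' (φ ⁻¹' T ∩ V) := by
      rintro a ⟨haT, haD⟩
      refine ⟨ψ a, ⟨?_, a, haD, rfl⟩, hφψ a haD⟩
      rwa [mem_preimage, hφψ a haD]
    exact (measure_mono h1).trans
      ((hφ.mono inter_subset_right).hausdorffMeasure_image_le (Nat.cast_nonneg m))
  have hpush : ∀ g : EuclideanSpace ℝ (Fin m) → ℝ≥0∞,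
      ∫⁻ a, g a ∂lam ≤ c' * ∫⁻ x in V, g (φ x) ∂μH[(m : ℝ)] := fun g =>
    calc ∫⁻ a, g a ∂lam ≤ ∫⁻ a, g a ∂(c' • ν) := lintegral_mono' hlamν le_rfl
      _ = c' * ∫⁻ a, g a ∂ν := by rw [lintegral_smul_measure, smul_eq_mul]
      _ ≤ _ := by gcongr; exact lintegral_map_le _ _
  set G : EuclideanSpace ℝ (Fin m) × EuclideanSpace ℝ (Fin m) → ℝ≥0∞ :=
    (separatedPairs D A').indicator (fun z => edist z.1 z.2 ^ (-q)) with hG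
  have hP := measurableSet_separatedPairs hD hA'
  have hGm : Measurable G :=
    ((measurable_fst.edist measurable_snd).pow_const _).indicator hP
  have hGF : ∀ᵐ x ∂(μH[(m : ℝ)].restrict V), ∀ᵐ y ∂(μH[(m : ℝ)].restrict V),
      c * G (φ x, φ y) ≤ F x y := by
    filter_upwards [hle, ae_restrict_mem hV] with x hx hxV
    filter_upwards [hx, ae_restrict_mem hV] with y hy hyV
    by_cases hz : (φ x, φ y) ∈ separatedPairs D A'
    · rw [hG, indicator_of_mem hz]
      refine hy fun hxy => hz.2.2 ?_
      obtain ⟨a, ha, rfl⟩ := hxV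
      obtain ⟨b, hb, rfl⟩ := hyV
      simp only [hA'def, mem_inter_iff, mem_preimage, hφψ a ha, hφψ b hb, ha, hb, true_and]
      exact hxy
    · rw [hG, indicator_of_notMem hz, mul_zero]
      exact zero_le
  have hfin : ∫⁻ x in V, ∫⁻ y in V, G (φ x, φ y) ∂μH[(m : ℝ)] ∂μH[(m : ℝ)] ≠ ⊤ := by
    have h1 : c * ∫⁻ x in V, ∫⁻ y in V, G (φ x, φ y) ∂μH[(m : ℝ)] ∂μH[(m : ℝ)] ≤
        ∫⁻ x in V, ∫⁻ y in V, F x y ∂μH[(m : ℝ)] ∂μH[(m : ℝ)] := by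
      rw [← lintegral_const_mul' _ _ hc]
      refine lintegral_mono_ae ?_
      filter_upwards [hGF] with x hx
      rw [← lintegral_const_mul' _ _ hc]
      exact lintegral_mono_ae hx
    intro htop
    rw [htop, ENNReal.mul_top hc0, top_le_iff] at h1
    exact hF h1
  have hmain : ∫⁻ z in separatedPairs D A', edist z.1 z.2 ^ (-q)
      ∂(μH[(m : ℝ)] : Measure (EuclideanSpace ℝ (Fin m))).prod μH[(m : ℝ)] ≠ ⊤ := by
    have hsub : separatedPairs D A' ⊆ D ×ˢ D := fun z hz => ⟨hz.1, hz.2.1⟩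
    rw [← Measure.restrict_restrict_of_subset hsub, ← Measure.prod_restrict,
      ← lintegral_indicator hP, lintegral_prod _ hGm.aemeasurable]
    -- One factor c' is paid for each of the two variables.
    refine ne_top_of_le_ne_top (ENNReal.mul_ne_top hc'top (ENNReal.mul_ne_top hc'top hfin)) ?_
    refine (hpush _).trans ?_
    gcongr c' * ?_
    rw [← lintegral_const_mul' _ _ hc'top]
    exact lintegral_mono fun x => hpush fun b => G (φ x, b)
  have hnull : ∀ S : Set X, ∀ T : Set (EuclideanSpace ℝ (Fin m)), S ⊆ ψ '' T → T ⊆ D →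
      μH[(m : ℝ)] T = 0 → μH[(m : ℝ)] S = 0 := by
    intro S T hST hTD hT
    have := (hψ.mono hTD).hausdorffMeasure_image_le (d := m) (Nat.cast_nonneg m)
    rw [hT, mul_zero] at this
    exact measure_mono_null hST (le_antisymm this zero_le)
  rcases measure_inter_eq_zero_or_diff_eq_zero μH[(m : ℝ)] hDc hD hA'
    (by simpa using hq) hmain with h | h
  · left
    refine hnull _ _ ?_ inter_subset_left h
    rintro _ ⟨⟨a, ha, rfl⟩, haA⟩
    exact ⟨a, ⟨ha, ha, haA⟩, rfl⟩
  · right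
    refine hnull _ _ ?_ sdiff_subset h
    rintro _ ⟨⟨a, ha, rfl⟩, haA⟩
    exact ⟨a, ⟨ha, fun h => haA h.2⟩, rfl⟩

end BiLipschitzTransfer

/-! ### Local dichotomy for the lifts, and its globalization by connectedness. -/

section Dichotomy

open Metric
open scoped NNReal Topology

variable {m : ℕ} {X Y : Type*} [EMetricSpace X] [MeasurableSpace X] [BorelSpace X]
  [ChartedSpace (EuclideanSpace ℝ (Fin m)) X]
  [RiemannianBundle (fun x : X => TangentSpace (𝓡 m) x)] [EMetricSpace Y]

/-- The energy increases with the domain of integration. -/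
lemma gagliardoEnergyOn_mono {Ω A B : Set X} (h : A ⊆ B) (s p : ℝ) (u : X → Y) :
    gagliardoEnergyOn m Ω A s p u ≤ gagliardoEnergyOn m Ω B s p u :=
  (lintegral_mono fun _ => lintegral_mono_set h).trans (lintegral_mono_set h)

lemma MemSobolev.memSobolevLoc {Ω : Set X} {s p : ℝ} {u : X → Y} (h : MemSobolev m Ω s p u) :
    MemSobolevLoc m Ω s p u :=
  ⟨h.1, fun _ hK _ => (gagliardoEnergyOn_mono hK s p u).trans_lt h.2⟩

/-- The energy only depends on the almost everywhere class of the map. -/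
lemma gagliardoEnergyOn_congr_ae {Ω A : Set X} (s p : ℝ) {u v : X → Y}
    (h : u =ᵐ[μH[(m : ℝ)].restrict A] v) :
    gagliardoEnergyOn m Ω A s p u = gagliardoEnergyOn m Ω A s p v := by
  refine lintegral_congr_ae ?_
  filter_upwards [h] with x hx
  refine lintegral_congr_ae ?_
  filter_upwards [h] with y hy
  rw [hx, hy]

lemma MemSobolev.congr_ae {Ω : Set X} {s p : ℝ} {u v : X → Y} (hv : MemSobolev m Ω s p v)
    (h : u =ᵐ[μH[(m : ℝ)].restrict Ω] v) : MemSobolev m Ω s p u :=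
  ⟨hv.1.congr h.symm, (gagliardoEnergyOn_congr_ae s p h).trans_lt hv.2⟩

variable [IsManifold (𝓡 m) ∞ X]
  [IsContMDiffRiemannianBundle (𝓡 m) ∞ (EuclideanSpace ℝ (Fin m))
    (fun x : X => TangentSpace (𝓡 m) x)] [IsRiemannianManifold (𝓡 m) X]

/-- Two lifts of the same map through a locally injective map, one of them continuous and the
other of finite energy, locally coincide or differ almost everywhere. -/
lemma exists_mem_nhds_coincidence_null {Z : Type*} {f : Y → Z} (hf : IsLocallyInjective f)
    {Ω : Set X} (hΩ : IsOpen Ω) {s p : ℝ} (hp : 0 ≤ p) (hsp : 1 ≤ s * p) {u v : X → Y}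
    (hu : ContinuousOn u Ω) (hum : AEStronglyMeasurable u (μH[(m : ℝ)].restrict Ω))
    (hv : MemSobolevLoc m Ω s p v)
    (huv : ∀ᵐ x ∂(μH[(m : ℝ)].restrict Ω), f (u x) = f (v x)) {x₀ : X} (hx₀ : x₀ ∈ Ω) :
    ∃ V ∈ 𝓝 x₀, μH[(m : ℝ)] (V ∩ {x | u x = v x}) = 0 ∨ μH[(m : ℝ)] (V ∩ {x | u x ≠ v x}) = 0 := by
  obtain ⟨U, hUo, hxU, hinj⟩ := hf (u x₀)
  obtain ⟨ε, hε, hεU⟩ := EMetric.isOpen_iff.1 hUo _ hxU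
  -- Half of ε leaves room for the triangle inequality; the minimum with 1 keeps δ finite, as ε may
  -- be `⊤`.
  set δ : ℝ≥0∞ := min (ε / 2) 1
  have hδ0 : δ ≠ 0 := (lt_min (ENNReal.half_pos hε.ne') one_pos).ne'
  have hδtop : δ ≠ ⊤ := ne_top_of_le_ne_top ENNReal.one_ne_top (min_le_right _ _)
  have hsep : ∀ z ∈ eball (u x₀) δ, ∀ w ∉ U, δ ≤ edist z w := by
    intro z hz w hw
    by_contra! hlt
    refine hw (hεU ?_)
    rw [mem_eball] at hz ⊢
    calc edist w (u x₀) ≤ edist z w + edist z (u x₀) := by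
          rw [edist_comm z w]; exact edist_triangle _ _ _
      _ < ε / 2 + ε / 2 := ENNReal.add_lt_add (hlt.trans_le (min_le_left _ _))
          (hz.trans_le (min_le_left _ _))
      _ = ε := ENNReal.add_halves ε
  have := ChartedSpace.locallyCompactSpace (EuclideanSpace ℝ (Fin m)) X
  -- Local finiteness of the energy is available only on compact sets, so K is taken compact in Ω
  -- with u(K) in the δ-ball.
  obtain ⟨K, hK, hKsub, hKc⟩ := local_compact_nhds
    (Filter.inter_mem (hΩ.mem_nhds hx₀) ((hu.continuousAt (hΩ.mem_nhds hx₀)).preimage_mem_nhds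
      (eball_mem_nhds (u x₀) (pos_iff_ne_zero.2 hδ0))))
  obtain ⟨C, hC, r, hr, ht, hDK, hV, hVo, hφ, hψ, hgeo⟩ := exists_chart_ball (m := m) x₀ hK
  set φ := extChartAt (𝓡 m) x₀ with hφdef
  set D := ball (φ x₀) r
  have hVK : φ.symm '' D ⊆ K := image_subset_iff.2 hDK
  have hVΩ : φ.symm '' D ⊆ Ω := fun x hx => (hKsub (hVK hx)).1
  have hres := Measure.restrict_mono hVΩ (le_refl (μH[(m : ℝ)] : Measure X))
  -- Measurable representatives make A a genuinely measurable set; it differs from the coincidence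
  -- set of u and v by a null set on the chart ball.
  set A : Set X := {x | hum.mk u x = hv.1.mk v x}
  have hA : MeasurableSet A :=
    hum.stronglyMeasurable_mk.measurableSet_eq_fun hv.1.stronglyMeasurable_mk
  have hgood : ∀ᵐ x ∂(μH[(m : ℝ)].restrict (φ.symm '' D)), x ∈ φ.symm '' D ∧
      (x ∈ A ↔ u x = v x) ∧ f (u x) = f (v x) := by
    filter_upwards [ae_restrict_mem hVo.measurableSet, ae_mono hres huv,
      ae_mono hres hum.ae_eq_mk, ae_mono hres hv.1.ae_eq_mk] with x h1 h2 h3 h4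
    exact ⟨h1, by rw [h3, h4]; rfl, h2⟩
  have hq : 0 ≤ (m : ℝ) + s * p := by positivity
  -- If v y were in U, injectivity there would force u y = v y. So v y is outside U, while v x = u x
  -- lies in the δ-ball.
  have hdist : ∀ x ∈ φ.symm '' D, ∀ y ∈ φ.symm '' D, u x = v x → u y ≠ v y →
      f (u y) = f (v y) → δ ≤ edist (v x) (v y) := by
    intro x hx y hy h1 h2 h3
    refine hsep _ ?_ _ fun hyU => h2 ?_
    · rw [← h1]; exact (hKsub (hVK hx)).2
    · refine hinj (hεU ?_) hyU h3
      exact (mem_eball.1 (hKsub (hVK hy)).2).trans_le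
        ((min_le_left _ _).trans ENNReal.half_le_self)
  refine ⟨φ.symm '' D, hV, ?_⟩
  have key := hausdorffMeasure_inter_eq_zero_or_diff_eq_zero (m := m) (φ := φ) (ψ := φ.symm)
    (D := D) (C := C) (q := m + s * p) (convex_ball _ _) isOpen_ball.measurableSet
    hVo.measurableSet (fun a ha => φ.right_inv (ht ha)) hφ hψ (by linarith) hA
    (F := fun x y => edist (v x) (v y) ^ p / geodesicEDistIn m Ω x y ^ ((m : ℝ) + s * p))
    -- The factor δ ^ p comes from the jump of v, the negative power of C from bounding the geodesic
    -- distance by C times the chart distance.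
    (c := δ ^ p * (C : ℝ≥0∞) ^ (-((m : ℝ) + s * p)))
    (mul_ne_zero (by simp [hδ0, hδtop]) (by simp [hC]))
    (ENNReal.mul_ne_top (by finiteness) (by simp [hC]))
    (((gagliardoEnergyOn_mono hVK s p v).trans_lt
      (hv.2 K (fun x hx => (hKsub hx).1) hKc)).ne)
    (by
      filter_upwards [hgood] with x hx
      filter_upwards [hgood] with y hy hxy
      have hd : δ ≤ edist (v x) (v y) := by
        rw [hx.2.1, hy.2.1] at hxy
        by_cases h : u x = v x
        · exact hdist x hx.1 y hy.1 h (fun h' => hxy (by tauto)) hy.2.2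
        · rw [edist_comm]
          exact hdist y hy.1 x hx.1 (by tauto) h hx.2.2
      obtain ⟨a, ha, rfl⟩ := hx.1
      obtain ⟨b, hb, rfl⟩ := hy.1
      rw [φ.right_inv (ht ha), φ.right_inv (ht hb), mul_assoc,
        ← ENNReal.mul_rpow_of_ne_top ENNReal.coe_ne_top (edist_ne_top _ _), ENNReal.rpow_neg,
        ← div_eq_mul_inv]
      gcongr
      exact hgeo Ω (fun a ha => hVΩ ⟨a, ha, rfl⟩) a ha b hb)
  have hnull := ae_iff.1 ((ae_restrict_iff' hVo.measurableSet).1 hgood)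
  refine key.imp (fun h => measure_mono_null (fun x hx => ?_) (measure_union_null h hnull))
    (fun h => measure_mono_null (fun x hx => ?_) (measure_union_null h hnull))
  · by_cases hxA : x ∈ A
    · exact Or.inl ⟨hx.1, hxA⟩
    · exact Or.inr fun hgx => hxA ((hgx hx.1).2.1.2 hx.2)
  · by_cases hxA : x ∈ A
    · exact Or.inr fun hgx => hx.2 ((hgx hx.1).2.1.1 hxA)
    · exact Or.inl ⟨hx.1, hxA⟩

/-- Nonempty open sets have positive Hausdorff measure. -/
lemma hausdorffMeasure_ne_zero_of_mem_nhds {x₀ : X} {V : Set X} (hV : V ∈ 𝓝 x₀) :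
    μH[(m : ℝ)] V ≠ 0 := by
  obtain ⟨C, -, r, hr, ht, hDV, -, -, hφ, -, -⟩ := exists_chart_ball (m := m) x₀ hV
  intro h
  have him := hφ.hausdorffMeasure_image_le (d := m) (Nat.cast_nonneg m)
  rw [measure_mono_null (image_subset_iff.2 hDV) h, mul_zero, image_image] at him
  refine (measure_ball_pos (μH[(m : ℝ)] : Measure (EuclideanSpace ℝ (Fin m)))
    (extChartAt (𝓡 m) x₀ x₀) hr).ne' (measure_mono_null ?_ (le_antisymm him zero_le))
  exact fun a ha => ⟨a, ha, (extChartAt (𝓡 m) x₀).right_inv (ht ha)⟩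

variable [SecondCountableTopology X]

/-- A locally null-or-conull subset of a connected set is null or conull. -/
lemma hausdorffMeasure_inter_null_or_inter_compl_null {Ω S : Set X} (hΩ : IsPreconnected Ω)
    (h : ∀ x ∈ Ω, ∃ V ∈ 𝓝 x, μH[(m : ℝ)] (V ∩ S) = 0 ∨ μH[(m : ℝ)] (V ∩ Sᶜ) = 0) :
    μH[(m : ℝ)] (Ω ∩ S) = 0 ∨ μH[(m : ℝ)] (Ω ∩ Sᶜ) = 0 := by
  have hopen : ∀ T : Set X, IsOpen {x | ∃ V ∈ 𝓝 x, μH[(m : ℝ)] (V ∩ T) = 0} := by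
    refine fun T => isOpen_iff_mem_nhds.2 ?_
    rintro x ⟨V, hV, hVT⟩
    filter_upwards [eventually_mem_nhds_iff.2 hV] with y hy using ⟨V, hy, hVT⟩
  have hnull : ∀ T : Set X, Ω ⊆ {x | ∃ V ∈ 𝓝 x, μH[(m : ℝ)] (V ∩ T) = 0} →
      μH[(m : ℝ)] (Ω ∩ T) = 0 := by
    refine fun T hT => measure_null_of_locally_null _ fun x hx => ?_
    obtain ⟨V, hV, hVT⟩ := hT hx.1
    refine ⟨_, Filter.inter_mem (mem_nhdsWithin_of_mem_nhds hV) self_mem_nhdsWithin, ?_⟩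
    exact measure_mono_null (fun y hy => mem_inter hy.1 hy.2.2) hVT
  -- The points near which S is null and those near which its complement is null form two open sets
  -- covering Ω. They are disjoint, since a common point would have a null neighbourhood.
  refine (isPreconnected_iff_subset_of_disjoint.1 hΩ _ _ (hopen S) (hopen Sᶜ) ?_ ?_).imp
    (hnull S) (hnull Sᶜ)
  · intro x hx
    obtain ⟨V, hV, hVS⟩ := h x hx
    exact hVS.imp (fun h => ⟨V, hV, h⟩) (fun h => ⟨V, hV, h⟩)
  · refine eq_empty_iff_forall_notMem.2 ?_
    rintro x ⟨-, ⟨V, hV, hVS⟩, W, hW, hWS⟩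
    refine hausdorffMeasure_ne_zero_of_mem_nhds (m := m) (Filter.inter_mem hV hW)
      (measure_mono_null (fun y hy => ?_) (measure_union_null hVS hWS))
    by_cases hyS : y ∈ S
    · exact Or.inl ⟨hy.1, hyS⟩
    · exact Or.inr ⟨hy.2, hyS⟩

lemma holdsAEOn_iff_ae_restrict {Ω : Set X} (hΩ : MeasurableSet Ω) {P : X → Prop} :
    HoldsAEOn m Ω P ↔ ∀ᵐ x ∂(μH[(m : ℝ)].restrict Ω), P x := by
  rw [HoldsAEOn, isNegligible_iff_hausdorffMeasure_eq_zero, ae_restrict_iff' hΩ, ae_iff]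
  simp only [Classical.not_imp]

/-- Two lifts of the same map through a locally injective map, one of them continuous and the
other of finite energy, coincide almost everywhere or differ almost everywhere. -/
theorem holdsAEOn_eq_or_ne {Z : Type*} {f : Y → Z} (hf : IsLocallyInjective f)
    {Ω : Set X} (hΩ : IsOpen Ω) (hΩc : IsPreconnected Ω) {s p : ℝ} (hp : 0 ≤ p)
    (hsp : 1 ≤ s * p) {u v : X → Y} (hu : ContinuousOn u Ω)
    (hum : AEStronglyMeasurable u (μH[(m : ℝ)].restrict Ω)) (hv : MemSobolevLoc m Ω s p v)
    (huv : HoldsAEOn m Ω fun x => f (u x) = f (v x)) :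
    HoldsAEOn m Ω (fun x => u x = v x) ∨ HoldsAEOn m Ω (fun x => u x ≠ v x) := by
  rw [holdsAEOn_iff_ae_restrict hΩ.measurableSet] at huv
  have h := hausdorffMeasure_inter_null_or_inter_compl_null (m := m) (S := {x | u x = v x}) hΩc
    fun x hx => exists_mem_nhds_coincidence_null hf hΩ hp hsp hu hum hv huv hx
  rw [HoldsAEOn, HoldsAEOn, isNegligible_iff_hausdorffMeasure_eq_zero,
    isNegligible_iff_hausdorffMeasure_eq_zero, or_comm]
  simpa only [ne_eq, not_not, inter_def, mem_ofPred_eq, mem_compl_iff] using h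

end Dichotomy

theorem mainTheorem8 {m n : ℕ} {M' C N : Type*}
    -- the ambient Riemannian manifold `M'` of the domain, of dimension `m`
    [EMetricSpace M'] [SecondCountableTopology M'] [MeasurableSpace M'] [BorelSpace M']
    [ChartedSpace (EuclideanSpace ℝ (Fin m)) M'] [IsManifold (𝓡 m) ∞ M']
    [RiemannianBundle (fun x : M' => TangentSpace (𝓡 m) x)]
    [IsContMDiffRiemannianBundle (𝓡 m) ∞ (EuclideanSpace ℝ (Fin m))
      (fun x : M' => TangentSpace (𝓡 m) x)]
    [IsRiemannianManifold (𝓡 m) M']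
    -- the covering space `C`, a connected Riemannian manifold
    [EMetricSpace C] [SecondCountableTopology C] [ConnectedSpace C]
    [ChartedSpace (EuclideanSpace ℝ (Fin n)) C] [IsManifold (𝓡 n) ∞ C]
    [RiemannianBundle (fun x : C => TangentSpace (𝓡 n) x)]
    [IsContMDiffRiemannianBundle (𝓡 n) ∞ (EuclideanSpace ℝ (Fin n))
      (fun x : C => TangentSpace (𝓡 n) x)]
    [IsRiemannianManifold (𝓡 n) C]
    -- the base `N`, a connected Riemannian manifold
    [EMetricSpace N] [SecondCountableTopology N] [ConnectedSpace N]
    [ChartedSpace (EuclideanSpace ℝ (Fin n)) N] [IsManifold (𝓡 n) ∞ N]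
    [RiemannianBundle (fun x : N => TangentSpace (𝓡 n) x)]
    [IsContMDiffRiemannianBundle (𝓡 n) ∞ (EuclideanSpace ℝ (Fin n))
      (fun x : N => TangentSpace (𝓡 n) x)]
    [IsRiemannianManifold (𝓡 n) N]
    (proj : C → N) (hproj : IsRiemannianCovering n proj)
    (M : Set M') (hMo : IsOpen M) (hMc : IsConnected M) (hMr : IsCompact (closure M))
    (s p : ℝ) (hs0 : 0 < s) (hs1 : s < 1) (hsp : 1 ≤ s * p) :
    (∀ u v : M' → C, MemSobolevLoc m M s p u → MemSobolevLoc m M s p v → ContinuousOn u M →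
      HoldsAEOn m M (fun x => proj (u x) = proj (v x)) →
      HoldsAEOn m M (fun x => u x = v x) ∨ HoldsAEOn m M (fun x => u x ≠ v x)) ∧
    (∀ u v : M' → C, MemSobolevLoc m M s p u → ¬ MemSobolev m M s p u → ContinuousOn u M →
      MemSobolev m M s p v → HoldsAEOn m M (fun x => proj (u x) = proj (v x)) →
      HoldsAEOn m M (fun x => u x ≠ v x)) := by
  have hp : 0 ≤ p := (pos_of_mul_pos_right (one_pos.trans_le hsp) hs0.le).le
  have hinj : IsLocallyInjective proj := hproj.isCoveringMap.isLocalHomeomorph.isLocallyInjective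
  refine ⟨fun u v hu hv huc huv => holdsAEOn_eq_or_ne hinj hMo hMc.isPreconnected hp hsp huc
    hu.1 hv huv, fun u v hu hu' huc hv huv => ?_⟩
  refine (holdsAEOn_eq_or_ne hinj hMo hMc.isPreconnected hp hsp huc hu.1 hv.memSobolevLoc
    huv).resolve_left fun h => hu' ?_
  exact hv.congr_ae ((holdsAEOn_iff_ae_restrict hMo.measurableSet).1 h)
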